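/- Let $d\ge 1$ be an integer and $0<s<1$. For $0<r<1$ put $$\Phi_{d,s,2}(r)=|\mathbb S^{d-2}|\int_{-1}^{1}\frac{(1-t^2)^{\frac{d-3}{2}}}{(1-2tr+r^2)^{\frac{d+2s}{2}}}\,dt\quad(d\ge 2),\qquad \Phi_{1,s,2}(r)=(1-r)^{-1-2s}+(1+r)^{-1-2s},$$ where $|\mathbb S^{d-2}|$ is the surface measure of the unit sphere in $\mathbb R^{d-1}$ (so $|\mathbb S^0|=2$), and $$\mathcal C(d,s,2,\alpha,\beta)=\int_0^1 r^{2s-1}\left(r^\alpha+r^\beta\right)\left|1-r^{\frac{d-\alpha-\beta-2s}{2}}\right|^{2}\Phi_{d,s,2}(r)\,dr .$$ Throughout, $1/\Gamma$ is understood to be $0$ at the poles $0,-1,-2,\dots$ of $\Gamma$. (i) If $\alpha,\beta,\alpha+\beta\in(-2s,d)$, then the integrals above converge and $$\mathcal C(d,s,2,\alpha,\beta)=\frac{\pi^{\frac d2}|\Gamma(-s)|}{\Gamma\left(\frac{d+2s}{2}\right)}\left[\frac{2\,\Gamma\left(\frac{d-\alpha+\beta+2s}{4}\right)\Gamma\l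eft(\frac{d+\alpha-\beta+2s}{4}\right)}{\Gamma\left(\frac{d+\alpha-\beta-2s}{4}\right)\Gamma\left(\frac{d-\alpha+\beta-2s}{4}\right)}-\frac{\Gamma\left(\frac{\alpha+2s}{2}\right)\Gamma\left(\frac{d-\alpha}{2}\right)}{\Gamma\left(\frac{d-\alpha-2s}{2}\right)\Gamma\left(\frac{\alpha}{2}\right)}-\frac{\Gamma\left(\frac{\beta+2s}{2}\right)\Gamma\left(\frac{d-\beta}{2}\right)}{\Gamma\left(\frac{d-\beta-2s}{2}\right)\Gamma\left(\frac{\beta}{2}\right)}\right].$$ (ii) In particular, if $\alpha,2\alpha\in(-2s,d)$, then $$\mathcal C(d,s,2,\alpha,\alpha)=\frac{2\pi^{\frac d2}|\Gamma(-s)|}{\Gamma\left(\frac{d+2s}{2}\right)}\left[\frac{\Gamma^2\left(\frac{d+2s}{4}\right)}{\Gamma^2\left(\frac{d-2s}{4}\right)}-\frac{\Gamma\left(\frac{\alpha+2s}{2}\right)\Gamma\left(\frac{d-\alpha}{2}\right)}{\Gamma\left(\frac{d-\alpha-2s}{2}\right)\Gamma\left(\frac{\alpha}{2}\right)}\right].$$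 (iii) In particular, for $\alpha=\beta=0$, $$\mathcal C(d,s,2,0,0)=\frac{2\pi^{\frac d2}|\Gamma(-s)|\,\Gamma^2\left(\frac{d+2s}{4}\right)}{\Gamma\left(\frac{d+2s}{2}\right)\Gamma^2\left(\frac{d-2s}{4}\right)}.$$ -/

import Mathlib

open MeasureTheory

noncomputable section

namespace WeightedHardy

/-- Surface measure of the unit sphere of `ℝⁿ`, that is `|𝕊^{n-1}|`. For `n = 1` it is the number
`2` of points of `𝕊⁰`. -/
def sphereArea (n : ℕ) : ℝ :=
  ((volume : Measure (EuclideanSpace ℝ (Fin n))).toSphere Set.univ).toReal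

/-- The integrand (in `t ∈ (-1, 1)`) of the angular integral that defines `Φ_{d,s,p}(r)` when
`d ≥ 2`. -/
def angularIntegrand (d : ℕ) (s p r t : ℝ) : ℝ :=
  (1 - t ^ 2) ^ (((d : ℝ) - 3) / 2) / (1 - 2 * t * r + r ^ 2) ^ (((d : ℝ) + s * p) / 2)

/-- The function `Φ_{d,s,p}(r)`, for `d ≥ 1` and `0 < r < 1`. -/
def Phi (d : ℕ) (s p r : ℝ) : ℝ :=
  if d = 1 then (1 - r) ^ (-1 - s * p) + (1 + r) ^ (-1 - s * p)
  else sphereArea (d - 1) * ∫ t in Set.Ioo (-1 : ℝ) 1, angularIntegrand d s p r t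

/-- The integrand (in `r ∈ (0, 1)`) of the integral that defines `𝒞(d,s,p,α,β)`. -/
def hardyIntegrand (d : ℕ) (s p α β r : ℝ) : ℝ :=
  r ^ (s * p - 1) * (r ^ α + r ^ β) *
    |1 - r ^ (((d : ℝ) - α - β - s * p) / p)| ^ p * Phi d s p r

/-- The constant `𝒞(d,s,p,α,β)`. -/
def hardyConst (d : ℕ) (s p α β : ℝ) : ℝ :=
  ∫ r in Set.Ioo (0 : ℝ) 1, hardyIntegrand d s p α β r

end WeightedHardy

end

section

open Set Filter Topology

namespace WeightedHardy

/-! Put `c = d/2`. Expanding `(1 - 2tr + r²)^(-(c+s))` in powers of `2r/(1+r²)` and integrating over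
the sphere writes `Φ` as a series in `r²/(1+r²)²` with positive coefficients (`hasSum_Phi`). The
radial weight, with its square multiplied out, consists of pairs of powers exchanged by `r ↦ 1/r`
(`hardy_weight_eq`). Against each term of the series such a pair gives a full beta integral
(`folded_beta_integral`), so the `j`-th term of the constant is a combination of general terms
`Γ(u+j)Γ(v+j)/(Γ(c+j) j!)` of Gauss series at 1, all with `u + v = c + s`.

Since `c - u - v = -s < 0`, each Gauss series diverges; its partial sums grow like `N^s`. Only
differences occur, and for them Gauss's formula survives (`tendsto_sum_gaussTerm_sub`). A contiguous
relation passes to the convergent series with parameter `c + 1`, up to boundary terms `N · gaussTerm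
u v c N`. Two such boundary terms differ by `O(N^(s-1))`, which vanishes because `s < 1`.

The integrand is nonnegative term by term, so convergence of the partial sums already yields both
integrability and the value of the integral. -/

/-! ### Termwise integration, the binomial series and the beta integral -/

lemma hasSum_congr {f g : ℕ → ℝ} {x y : ℝ} (h : HasSum f x) (hfg : ∀ n, g n = f n)
    (hxy : y = x) : HasSum g y := by
  rwa [funext hfg, hxy]

/-- Termwise integration of a series whose terms have summable `L¹` norms. -/
lemma integrableOn_and_hasSum_integral {F : ℕ → ℝ → ℝ} {f : ℝ → ℝ} {S : Set ℝ}
    (hS : MeasurableSet S) (hF : ∀ n, IntegrableOn (F n) S)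
    (hsum : Summable fun n => ∫ x in S, ‖F n x‖) (hf : ∀ x ∈ S, HasSum (fun n => F n x) (f x)) :
    IntegrableOn f S ∧ HasSum (fun n => ∫ x in S, F n x) (∫ x in S, f x) := by
  constructor
  · refine ⟨?_, ?_⟩
    · refine aestronglyMeasurable_of_tendsto_ae atTop
        (f := fun n x => ∑ i ∈ Finset.range n, F i x) (fun n => ?_) ?_
      · exact (integrable_finsetSum _ fun i _ => hF i).aestronglyMeasurable
      · filter_upwards [ae_restrict_mem hS] with x hx
        exact (hf x hx).tendsto_sum_nat
    · have h1 : ∫⁻ x in S, ‖f x‖ₑ ≤ ∫⁻ x in S, ∑' n, ‖F n x‖ₑ := by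
        refine lintegral_mono_ae ?_
        filter_upwards [ae_restrict_mem hS] with x hx
        rw [← (hf x hx).tsum_eq]
        exact enorm_tsum_le_tsum_enorm
      refine h1.trans_lt ?_
      rw [lintegral_tsum fun n => (hF n).aestronglyMeasurable.enorm]
      have h2 : ∀ n, ∫⁻ x in S, ‖F n x‖ₑ = ENNReal.ofReal (∫ x in S, ‖F n x‖) := fun n =>
        (ofReal_integral_norm_eq_lintegral_enorm (hF n)).symm
      simp_rw [h2]
      rw [← ENNReal.ofReal_tsum_of_nonneg (fun n => by positivity) hsum]
      exact ENNReal.ofReal_lt_top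
  · have := hasSum_integral_of_summable_integral_norm hF hsum
    rwa [setIntegral_congr_fun hS (g := f) fun x hx => (hf x hx).tsum_eq] at this

lemma choose_add_nat_sub_one {a : ℝ} (ha : 0 < a) (n : ℕ) :
    Ring.choose (a + n - 1) n = Real.Gamma (a + n) / (Real.Gamma a * n.factorial) := by
  have h1 : Ring.choose (a + n - 1) n = Ring.multichoose a n := by
    rw [Ring.choose]; congr 1; ring
  have h2 := Ring.factorial_nsmul_multichoose_eq_ascPochhammer a n
  have h3 : ∀ n : ℕ, Real.Gamma (a + n) = Real.Gamma a * (ascPochhammer ℝ n).eval a := by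
    intro n
    induction n with
    | zero => simp
    | succ n ih =>
      rw [ascPochhammer_succ_eval, ← mul_assoc, ← ih, mul_comm, ← Real.Gamma_add_one (by positivity)]
      push_cast; ring_nf
  rw [h1, h3, ← Polynomial.ascPochhammer_smeval_eq_eval, ← h2, nsmul_eq_mul]
  have := (Real.Gamma_pos_of_pos ha).ne'
  field_simp

/-- The binomial series of `(1 - x) ^ (-a)`. -/
lemma hasSum_one_sub_rpow_neg {a x : ℝ} (ha : 0 < a) (hx : |x| < 1) :
    HasSum (fun n : ℕ => Real.Gamma (a + n) / (Real.Gamma a * n.factorial) * x ^ n)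
      ((1 - x) ^ (-a)) := by
  have h := (Real.one_div_one_sub_rpow_hasFPowerSeriesOnBall_zero a).hasSum (y := x)
    (by simpa [enorm_eq_nnnorm, ← NNReal.coe_lt_one] using hx)
  have h0 : 0 ≤ 1 - x := by linarith [le_abs_self x]
  simpa [Real.rpow_neg h0, choose_add_nat_sub_one ha, mul_comm] using h

lemma beta_integral {p q : ℝ} (hp : 0 < p) (hq : 0 < q) :
    IntegrableOn (fun x : ℝ => x ^ (p - 1) * (1 - x) ^ (q - 1)) (Ioo 0 1) ∧
    ∫ x in Ioo (0 : ℝ) 1, x ^ (p - 1) * (1 - x) ^ (q - 1) =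
      Real.Gamma p * Real.Gamma q / Real.Gamma (p + q) := by
  have hc := Complex.betaIntegral_convergent (u := p) (v := q) (by simpa) (by simpa)
  rw [intervalIntegrable_iff_integrableOn_Ioo_of_le zero_le_one] at hc
  have he : ∀ x ∈ Ioo (0 : ℝ) 1,
      (x : ℂ) ^ ((p : ℂ) - 1) * (1 - (x : ℂ)) ^ ((q : ℂ) - 1) =
        ((x ^ (p - 1) * (1 - x) ^ (q - 1) : ℝ) : ℂ) := by
    intro x hx
    have h1 : 0 ≤ 1 - x := by linarith [hx.2]
    push_cast [Complex.ofReal_cpow hx.1.le, Complex.ofReal_cpow h1]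
    rfl
  rw [integrableOn_congr_fun he measurableSet_Ioo] at hc
  refine ⟨by simpa using! hc.re, ?_⟩
  have hv := Complex.betaIntegral_eq_Gamma_mul_div p q (by simpa) (by simpa)
  rw [Complex.betaIntegral, intervalIntegral.integral_of_le zero_le_one,
    integral_Ioc_eq_integral_Ioo, setIntegral_congr_fun measurableSet_Ioo he,
    integral_complex_ofReal] at hv
  simp only [← Complex.ofReal_add, Complex.Gamma_ofReal] at hv
  exact_mod_cast hv

/-! ### Gauss's theorem and its extension to differences of divergent series -/

/-- Gauss's summation theorem. -/
lemma hasSum_gauss {u v c : ℝ} (hu : 0 < u) (hv : 0 < v) (hc : u + v < c) :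
    HasSum (fun j : ℕ => Real.Gamma (u + j) * Real.Gamma (v + j) /
        (Real.Gamma (c + j) * j.factorial))
      (Real.Gamma u * Real.Gamma v * Real.Gamma (c - u - v) /
        (Real.Gamma (c - u) * Real.Gamma (c - v))) := by
  have hcv : 0 < c - v := by linarith
  have hcuv : 0 < c - u - v := by linarith
  have hGu := Real.Gamma_pos_of_pos hu
  have hGcv := Real.Gamma_pos_of_pos hcv
  set k : ℕ → ℝ := fun n => Real.Gamma (u + n) / (Real.Gamma u * n.factorial) with hk
  have hk0 : ∀ n, 0 ≤ k n := fun n => by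
    have := Real.Gamma_pos_of_pos (show 0 < u + n by positivity)
    positivity
  set F : ℕ → ℝ → ℝ := fun n x => k n * (x ^ (v + n - 1) * (1 - x) ^ (c - v - 1)) with hF
  have hb := fun n : ℕ => beta_integral (show 0 < v + n by positivity) hcv
  have hint : ∀ n, ∫ x in Ioo (0 : ℝ) 1, F n x =
      k n * (Real.Gamma (v + n) * Real.Gamma (c - v) / Real.Gamma (c + n)) := fun n => by
    rw [hF, integral_const_mul, (hb n).2]
    ring_nf
  -- Euler's integral: the binomial series of `(1-x)^(-u)` is integrated against the beta weight
  -- `x^(v-1) (1-x)^(c-v-1)`.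
  have hFs : ∀ x ∈ Ioo (0 : ℝ) 1,
      HasSum (fun n => F n x) (x ^ (v - 1) * (1 - x) ^ (c - u - v - 1)) := by
    intro x hx
    have h1x : 0 < 1 - x := by linarith [hx.2]
    have h := (hasSum_one_sub_rpow_neg hu (x := x) (by rw [abs_of_pos hx.1]; exact hx.2)).mul_left
      (x ^ (v - 1) * (1 - x) ^ (c - v - 1))
    refine hasSum_congr h (fun n => ?_) ?_
    · simp only [hF, hk]
      rw [show v + n - 1 = (v - 1) + n by ring, Real.rpow_add hx.1, Real.rpow_natCast]
      ring
    · rw [mul_assoc, ← Real.rpow_add h1x]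
      ring_nf
  have hFnn : ∀ n, ∀ x ∈ Ioo (0 : ℝ) 1, 0 ≤ F n x := fun n x hx => by
    have h1x : 0 < 1 - x := by linarith [hx.2]
    have := hx.1
    have := hk0 n
    positivity
  have hB := beta_integral hv hcuv
  have hsum : Summable fun n => ∫ x in Ioo (0 : ℝ) 1, ‖F n x‖ := by
    refine summable_of_sum_range_le (c := ∫ x in Ioo (0 : ℝ) 1,
      x ^ (v - 1) * (1 - x) ^ (c - u - v - 1)) (fun n => by positivity) fun n => ?_
    rw [← integral_finsetSum _ fun i _ => ((hb i).1.const_mul (k i)).norm]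
    refine setIntegral_mono_on (integrable_finsetSum _ fun i _ => ((hb i).1.const_mul (k i)).norm)
      hB.1 measurableSet_Ioo fun x hx => ?_
    rw [Finset.sum_congr rfl fun i _ => Real.norm_of_nonneg (hFnn i x hx)]
    exact sum_le_hasSum _ (fun i _ => hFnn i x hx) (hFs x hx)
  have h := (integrableOn_and_hasSum_integral measurableSet_Ioo
    (fun n => (hb n).1.const_mul (k n)) hsum hFs).2
  rw [hB.2] at h
  have h' := h.mul_left (Real.Gamma u / Real.Gamma (c - v))
  refine hasSum_congr h' (fun n => ?_) ?_
  · rw [hint]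
    simp only [hk]
    field_simp
  · rw [show v + (c - u - v) = c - u by ring]
    field_simp

/-- The general term of the Gauss series at `1`, normalised by Gamma factors. -/
noncomputable def gaussTerm (u v c : ℝ) (j : ℕ) : ℝ :=
  Real.Gamma (u + j) * Real.Gamma (v + j) / (Real.Gamma (c + j) * j.factorial)

lemma Gamma_add_nat_succ {x : ℝ} (hx : 0 < x) (n : ℕ) :
    Real.Gamma (x + (n + 1 : ℕ)) = (x + n) * Real.Gamma (x + n) := by
  rw [← Real.Gamma_add_one (by positivity)]
  push_cast
  ring_nf

/-- Contiguous relation between the partial sums of the Gauss series for `c` and `c + 1`. -/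
lemma sum_gaussTerm {u v c s : ℝ} (hu : 0 < u) (hv : 0 < v) (hc : 0 < c) (h : u + v = c + s)
    (N : ℕ) :
    -s * ∑ j ∈ Finset.range N, gaussTerm u v c j =
      (c - u) * (c - v) * ∑ j ∈ Finset.range N, gaussTerm u v (c + 1) j -
        N * gaussTerm u v c N := by
  induction N with
  | zero => simp
  | succ n ih =>
    rw [Finset.sum_range_succ, Finset.sum_range_succ, mul_add, ih]
    have hG := (Real.Gamma_pos_of_pos (show 0 < c + n by positivity)).ne'
    have hcn : c + n ≠ 0 := by positivity
    obtain rfl : s = u + v - c := by linarith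
    simp only [gaussTerm]
    -- Once the common Gamma factors are cleared, the induction step is a polynomial identity in
    -- `n`.
    rw [show c + 1 + (n : ℝ) = c + (n + 1 : ℕ) by push_cast; ring, Gamma_add_nat_succ hu,
      Gamma_add_nat_succ hv, Gamma_add_nat_succ hc, Nat.factorial_succ]
    push_cast
    field_simp
    ring

/-- Euler's limit formula for `Γ(u)`, read as an asymptotic for `Γ(u + n + 1)`. -/
lemma tendsto_Gamma_add_nat_div {u : ℝ} (hu : 0 < u) :
    Tendsto (fun n : ℕ => Real.Gamma (u + (n + 1 : ℕ)) / ((n : ℝ) ^ u * n.factorial))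
      atTop (𝓝 1) := by
  have hG := (Real.Gamma_pos_of_pos hu).ne'
  have h := (tendsto_const_nhds (x := Real.Gamma u)).div (Real.GammaSeq_tendsto_Gamma u) hG
  rw [div_self hG] at h
  refine h.congr' ?_
  filter_upwards [eventually_gt_atTop 0] with n hn
  have hp : ∀ m : ℕ, Real.Gamma (u + m) = Real.Gamma u * ∏ j ∈ Finset.range m, (u + j) := by
    intro m
    induction m with
    | zero => simp
    | succ m ih => rw [Gamma_add_nat_succ hu, ih, Finset.prod_range_succ]; ring
  rw [Pi.div_apply, Real.GammaSeq, hp, div_div_eq_mul_div]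

/-- Two products of Gamma factors with the same argument sum agree up to a relative error
`O(1 / n)`. -/
lemma exists_abs_Gamma_ratio_sub_one_le {u v u' v' : ℝ} (hu : 0 < u) (hv : 0 < v) (hu' : 0 < u')
    (hv' : 0 < v') (h : u + v = u' + v') :
    ∃ B : ℝ, ∀ n : ℕ,
      |Real.Gamma (u + (n + 1 : ℕ)) * Real.Gamma (v + (n + 1 : ℕ)) /
        (Real.Gamma (u' + (n + 1 : ℕ)) * Real.Gamma (v' + (n + 1 : ℕ))) - 1| ≤ B / (n + 1) := by
  set q : ℕ → ℝ := fun n => Real.Gamma (u + (n + 1 : ℕ)) * Real.Gamma (v + (n + 1 : ℕ)) /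
        (Real.Gamma (u' + (n + 1 : ℕ)) * Real.Gamma (v' + (n + 1 : ℕ))) with hq
  have hG : ∀ {x : ℝ}, 0 < x → ∀ n : ℕ, 0 < Real.Gamma (x + n) := fun hx n =>
    Real.Gamma_pos_of_pos (by positivity)
  have hlim : Tendsto q atTop (𝓝 1) := by
    have h1 := ((tendsto_Gamma_add_nat_div hu).mul (tendsto_Gamma_add_nat_div hv)).div
      ((tendsto_Gamma_add_nat_div hu').mul (tendsto_Gamma_add_nat_div hv')) (by norm_num)
    simp only [mul_one, div_one] at h1
    refine h1.congr' ?_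
    filter_upwards [eventually_gt_atTop 0] with n hn
    have hn' : (0 : ℝ) < n := by exact_mod_cast hn
    have e : (n : ℝ) ^ u * (n : ℝ) ^ v = (n : ℝ) ^ u' * (n : ℝ) ^ v' := by
      rw [← Real.rpow_add hn', ← Real.rpow_add hn', h]
    have h2 := (hG hu' (n + 1)).ne'
    have h3 := (hG hv' (n + 1)).ne'
    simp only [hq, Pi.div_apply]
    rw [div_mul_div_comm, div_mul_div_comm, mul_mul_mul_comm ((n : ℝ) ^ u), e,
      mul_mul_mul_comm ((n : ℝ) ^ u')]
    rw [div_div_div_cancel_right₀ (by positivity)]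
  obtain ⟨K, hK⟩ := hlim.bddAbove_range
  have hqK : ∀ n, q n ≤ K := fun n => hK ⟨n, rfl⟩
  have hq0 : ∀ n, 0 < q n := fun n =>
    div_pos (mul_pos (hG hu _) (hG hv _)) (mul_pos (hG hu' _) (hG hv' _))
  have hK0 : 0 < K := (hq0 0).trans_le (hqK 0)
  -- Since `u + v = u' + v'`, the products `(u+m)(v+m)` and `(u'+m)(v'+m)` differ by the constant
  -- `uv - u'v'`. The increments of `q` are thus `O(n⁻²)`, and the factor 2 fits them under the
  -- telescoping `B/(n+1) - B/(n+2)`.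
  set B := 2 * (K * |u * v - u' * v'|) with hB
  have hstep : ∀ n : ℕ, |q (n + 1) - q n| ≤ B / (n + 1) - B / ((n + 1 : ℕ) + 1) := by
    intro n
    have e : q (n + 1) - q n =
        q n * (u * v - u' * v') / ((u' + (n + 1 : ℕ)) * (v' + (n + 1 : ℕ))) := by
      have h2 := (hG hu' (n + 1)).ne'
      have h3 := (hG hv' (n + 1)).ne'
      have h4 : u' + ((n + 1 : ℕ) : ℝ) ≠ 0 := by positivity
      have h5 : v' + ((n + 1 : ℕ) : ℝ) ≠ 0 := by positivity
      obtain rfl : v = u' + v' - u := by linarith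
      simp only [hq]
      rw [Gamma_add_nat_succ hu (n + 1), Gamma_add_nat_succ hv (n + 1),
        Gamma_add_nat_succ hu' (n + 1), Gamma_add_nat_succ hv' (n + 1)]
      field_simp
      ring
    have e2 : B / (n + 1) - B / ((n + 1 : ℕ) + 1) =
        K * |u * v - u' * v'| / (((n : ℝ) + 1) * (n + 2) / 2) := by
      rw [hB]; push_cast; field_simp; ring
    rw [e, e2, abs_div, abs_mul, abs_of_pos (hq0 n),
      abs_of_pos (show 0 < (u' + ((n + 1 : ℕ) : ℝ)) * (v' + ((n + 1 : ℕ) : ℝ)) by positivity)]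
    have hle : ((n : ℝ) + 1) * (n + 2) / 2 ≤
        (u' + ((n + 1 : ℕ) : ℝ)) * (v' + ((n + 1 : ℕ) : ℝ)) := by
      push_cast
      have : (0 : ℝ) ≤ n := n.cast_nonneg
      have h1 : ((n : ℝ) + 1) * (n + 1) ≤ (u' + (n + 1)) * (v' + (n + 1)) := 
        mul_le_mul (by linarith) (by linarith) (by linarith) (by linarith)
      nlinarith
    have := hqK n
    gcongr
  have hB0 : Tendsto (fun n : ℕ => B / ((n : ℝ) + 1)) atTop (𝓝 0) :=
    tendsto_const_nhds.div_atTop (tendsto_natCast_atTop_atTop.atTop_add tendsto_const_nhds)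
  refine ⟨B, fun n => ?_⟩
  -- The increment bound makes `q ± B/(n+1)` monotone in opposite directions, both with limit 1.
  have hup : Antitone fun n : ℕ => q n + B / ((n : ℝ) + 1) :=
    antitone_nat_of_succ_le fun n => by linarith [(abs_le.1 (hstep n)).2]
  have hlo : Monotone fun n : ℕ => q n - B / ((n : ℝ) + 1) :=
    monotone_nat_of_le_succ fun n => by linarith [(abs_le.1 (hstep n)).1]
  have h1 := hup.le_of_tendsto (by simpa using hlim.add hB0) n
  have h2 := hlo.ge_of_tendsto (by simpa using hlim.sub hB0) n
  rw [abs_le]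
  constructor <;> linarith

/-- Each boundary term is of order `N^s`; the two have ratio `1 + O(1/N)`, so their difference is
`O(N^(s-1))`. -/
lemma tendsto_mul_gaussTerm_sub {u v u' v' c s : ℝ} (hu : 0 < u) (hv : 0 < v) (hu' : 0 < u')
    (hv' : 0 < v') (hc : 0 < c) (hs : s < 1) (h : u + v = c + s) (h' : u' + v' = c + s) :
    Tendsto (fun N : ℕ => (N : ℝ) * (gaussTerm u v c N - gaussTerm u' v' c N)) atTop (𝓝 0) := by
  rw [← tendsto_add_atTop_iff_nat 1]
  obtain ⟨B, hB⟩ := exists_abs_Gamma_ratio_sub_one_le hu hv hu' hv' (h.trans h'.symm)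
  set q : ℕ → ℝ := fun n => Real.Gamma (u + (n + 1 : ℕ)) * Real.Gamma (v + (n + 1 : ℕ)) /
        (Real.Gamma (u' + (n + 1 : ℕ)) * Real.Gamma (v' + (n + 1 : ℕ))) with hq
  have hG : ∀ {x : ℝ}, 0 < x → ∀ n : ℕ, 0 < Real.Gamma (x + n) := fun hx n =>
    Real.Gamma_pos_of_pos (by positivity)
  have h1 := ((tendsto_Gamma_add_nat_div hu').mul (tendsto_Gamma_add_nat_div hv')).div
    (tendsto_Gamma_add_nat_div hc) one_ne_zero
  have h2 : Tendsto (fun n : ℕ => (n : ℝ) ^ s * (q n - 1)) atTop (𝓝 0) := by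
    have h3 : Tendsto (fun n : ℕ => B * (n : ℝ) ^ (-(1 - s))) atTop (𝓝 0) := by
      simpa using ((tendsto_rpow_neg_atTop (show 0 < 1 - s by linarith)).comp
        tendsto_natCast_atTop_atTop).const_mul B
    refine squeeze_zero_norm' ?_ h3
    filter_upwards [eventually_gt_atTop 0] with n hn
    have hn' : (0 : ℝ) < n := by exact_mod_cast hn
    have hB0 : 0 ≤ B := by
      have := (abs_nonneg _).trans (hB 0)
      simpa using this
    rw [norm_mul, Real.norm_of_nonneg (by positivity), Real.norm_eq_abs]
    calc (n : ℝ) ^ s * |q n - 1| ≤ (n : ℝ) ^ s * (B / n) := by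
          gcongr
          exact (hB n).trans (by gcongr; linarith)
      _ = B * (n : ℝ) ^ (-(1 - s)) := by
          rw [show -(1 - s) = s - 1 by ring, Real.rpow_sub_one hn'.ne']
          ring
  have h4 := h1.mul h2
  rw [mul_zero] at h4
  refine h4.congr' ?_
  filter_upwards [eventually_gt_atTop 0] with n hn
  have hn' : (0 : ℝ) < n := by exact_mod_cast hn
  have e : (n : ℝ) ^ u' * (n : ℝ) ^ v' = (n : ℝ) ^ c * (n : ℝ) ^ s := by
    rw [← Real.rpow_add hn', ← Real.rpow_add hn', h']
  have e1 := (hG hu' (n + 1)).ne'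
  have e2 := (hG hv' (n + 1)).ne'
  have e3 := (hG hc (n + 1)).ne'
  simp only [Pi.div_apply]
  rw [div_mul_div_comm, mul_mul_mul_comm ((n : ℝ) ^ u'), e]
  simp only [gaussTerm, hq]
  rw [Nat.factorial_succ]
  have e5 : ((n + 1 : ℕ) : ℝ) ≠ 0 := by positivity
  have e6 : ((n : ℕ) : ℝ) + 1 ≠ 0 := by positivity
  have e7 : (n : ℝ) ^ c ≠ 0 := by positivity
  have e8 : (n : ℝ) ^ s ≠ 0 := by positivity
  rw [Nat.cast_mul]
  field_simp

/-- The functional equation of `1/Γ` holds at the poles too, because `Real.Gamma` is 0 there. No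
case split is then needed when `c - u` or `c - v` is a pole. -/
lemma mul_inv_Gamma_add_one (x : ℝ) : x * (Real.Gamma (x + 1))⁻¹ = (Real.Gamma x)⁻¹ := by
  rcases eq_or_ne x 0 with rfl | hx
  · simp [Real.Gamma_zero]
  · rw [Real.Gamma_add_one hx, mul_inv, mul_inv_cancel_left₀ hx]

/-- Gauss's summation theorem for differences, valid beyond the range of convergence of the
individual series. -/
lemma tendsto_sum_gaussTerm_sub {u v u' v' c s : ℝ} (hu : 0 < u) (hv : 0 < v) (hu' : 0 < u')
    (hv' : 0 < v') (hc : 0 < c) (hs0 : 0 < s) (hs : s < 1) (h : u + v = c + s)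
    (h' : u' + v' = c + s) :
    Tendsto (fun N : ℕ => ∑ j ∈ Finset.range N, (gaussTerm u v c j - gaussTerm u' v' c j)) atTop
      (𝓝 (Real.Gamma (-s) *
        (Real.Gamma u * Real.Gamma v / (Real.Gamma (c - u) * Real.Gamma (c - v)) -
          Real.Gamma u' * Real.Gamma v' / (Real.Gamma (c - u') * Real.Gamma (c - v'))))) := by
  have key : ∀ {x y : ℝ}, 0 < x → 0 < y → x + y = c + s →
      Tendsto (fun N : ℕ => (c - x) * (c - y) *
        ∑ j ∈ Finset.range N, gaussTerm x y (c + 1) j) atTop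
        (𝓝 (-s * (Real.Gamma (-s) *
          (Real.Gamma x * Real.Gamma y / (Real.Gamma (c - x) * Real.Gamma (c - y)))))) := by
    intro x y hx hy hxy
    -- With `c + 1` in place of `c` the excess is `1 - s > 0`, so Gauss's theorem applies.
    have hg := (hasSum_gauss hx hy (show x + y < c + 1 by linarith)).tendsto_sum_nat.const_mul
      ((c - x) * (c - y))
    have e : (c - x) * (c - y) * (Real.Gamma x * Real.Gamma y * Real.Gamma (c + 1 - x - y) /
        (Real.Gamma (c + 1 - x) * Real.Gamma (c + 1 - y))) = -s * (Real.Gamma (-s) *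
          (Real.Gamma x * Real.Gamma y / (Real.Gamma (c - x) * Real.Gamma (c - y)))) := by
      rw [show c + 1 - x - y = -s + 1 by linarith, Real.Gamma_add_one (by linarith),
        div_eq_mul_inv _ (Real.Gamma (c - x) * _), mul_inv, ← mul_inv_Gamma_add_one (c - x),
        ← mul_inv_Gamma_add_one (c - y), show c - x + 1 = c + 1 - x by ring,
        show c - y + 1 = c + 1 - y by ring, div_eq_mul_inv, mul_inv]
      ring
    rw [e] at hg
    exact hg
  have hlim := (((key hu hv h).sub (key hu' hv' h')).sub
    (tendsto_mul_gaussTerm_sub hu hv hu' hv' hc hs h h')).const_mul (-s)⁻¹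
  have hs' : -s ≠ 0 := by linarith
  rw [sub_zero, ← mul_sub, ← mul_sub, inv_mul_cancel_left₀ hs'] at hlim
  refine hlim.congr fun N => ?_
  rw [inv_mul_eq_iff_eq_mul₀ hs', Finset.sum_sub_distrib, mul_sub (-s),
    sum_gaussTerm hu hv hc h, sum_gaussTerm hu' hv' hc h']
  ring

/-! ### Sphere area, angular moments and the expansion of `Φ` -/

lemma sphereArea_eq {n : ℕ} (hn : 1 ≤ n) :
    sphereArea n = 2 * Real.pi ^ ((n : ℝ) / 2) / Real.Gamma (n / 2) := by
  have : Nonempty (Fin n) := ⟨⟨0, hn⟩⟩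
  have hn' : (0 : ℝ) < n := by exact_mod_cast hn
  have hG := Real.Gamma_pos_of_pos (show (0 : ℝ) < n / 2 by positivity)
  rw [sphereArea, Measure.toSphere_apply_univ, EuclideanSpace.volume_ball,
    Real.Gamma_add_one (by positivity)]
  simp only [Fintype.card_fin, finrank_euclideanSpace, ENNReal.ofReal_one, one_pow, one_mul,
    ENNReal.toReal_mul, ENNReal.toReal_natCast]
  rw [ENNReal.toReal_ofReal (by positivity), Real.sqrt_eq_rpow, ← Real.rpow_mul_natCast
    Real.pi_pos.le, show (1 : ℝ) / 2 * n = n / 2 by ring]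
  field_simp

lemma integral_pow_mul_one_sub_sq_rpow_Ioo_zero_one {q : ℝ} (hq : 0 < q) (n : ℕ) :
    IntegrableOn (fun t : ℝ => t ^ n * (1 - t ^ 2) ^ (q - 1)) (Ioo 0 1) ∧
    ∫ t in Ioo (0 : ℝ) 1, t ^ n * (1 - t ^ 2) ^ (q - 1) =
      Real.Gamma ((n + 1) / 2) * Real.Gamma q / Real.Gamma ((n + 1) / 2 + q) / 2 := by
  have himg : (fun t : ℝ => t ^ 2) '' Ioo 0 1 = Ioo 0 1 := by
    ext y
    constructor
    · rintro ⟨t, ht, rfl⟩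
      exact ⟨by have := ht.1; positivity, pow_lt_one₀ ht.1.le ht.2 two_ne_zero⟩
    · intro hy
      exact ⟨√y, ⟨Real.sqrt_pos.2 hy.1, by rw [Real.sqrt_lt' one_pos]; simpa using hy.2⟩,
        Real.sq_sqrt hy.1.le⟩
  have hinj : InjOn (fun t : ℝ => t ^ 2) (Ioo 0 1) := fun x hx y hy h =>
    (pow_left_inj₀ hx.1.le hy.1.le two_ne_zero).1 h
  have hder : ∀ x ∈ Ioo (0 : ℝ) 1, HasDerivWithinAt (fun t : ℝ => t ^ 2) (2 * x) (Ioo 0 1) x :=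
    fun x _ => by simpa using (hasDerivAt_pow 2 x).hasDerivWithinAt
  have he : ∀ t ∈ Ioo (0 : ℝ) 1,
      |2 * t| • ((t ^ 2) ^ (((n : ℝ) + 1) / 2 - 1) * (1 - t ^ 2) ^ (q - 1)) =
        2 * (t ^ n * (1 - t ^ 2) ^ (q - 1)) := by
    intro t ht
    have h0 := ht.1
    rw [abs_of_pos (by positivity), smul_eq_mul, ← Real.rpow_natCast t 2, ← Real.rpow_mul h0.le,
      ← mul_assoc, mul_assoc 2 t, mul_comm t, ← Real.rpow_add_one h0.ne', mul_assoc,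
      ← Real.rpow_natCast t n]
    push_cast
    ring_nf
  obtain ⟨hi, hv⟩ := beta_integral (show 0 < ((n : ℝ) + 1) / 2 by positivity) hq
  rw [← himg, integrableOn_image_iff_integrableOn_abs_deriv_smul measurableSet_Ioo hder hinj,
    integrableOn_congr_fun he measurableSet_Ioo] at hi
  rw [← himg, integral_image_eq_integral_abs_deriv_smul measurableSet_Ioo hder hinj,
    setIntegral_congr_fun measurableSet_Ioo he, integral_const_mul] at hv
  refine ⟨?_, by linarith⟩
  have := hi.const_mul (1 / 2)
  simpa using! this

lemma integral_pow_mul_one_sub_sq_rpow {q : ℝ} (hq : 0 < q) (n : ℕ) :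
    IntegrableOn (fun t : ℝ => t ^ n * (1 - t ^ 2) ^ (q - 1)) (Ioo (-1) 1) ∧
    ∫ t in Ioo (-1 : ℝ) 1, t ^ n * (1 - t ^ 2) ^ (q - 1) =
      (1 + (-1) ^ n) *
        (Real.Gamma ((n + 1) / 2) * Real.Gamma q / Real.Gamma ((n + 1) / 2 + q) / 2) := by
  obtain ⟨hi, hv⟩ := integral_pow_mul_one_sub_sq_rpow_Ioo_zero_one hq n
  set g : ℝ → ℝ := fun t => t ^ n * (1 - t ^ 2) ^ (q - 1) with hg
  have hneg : ∀ t, g (-t) = (-1) ^ n * g t := fun t => by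
    simp only [hg]; rw [neg_pow, neg_sq]; ring
  have hi1 : IntervalIntegrable g volume 0 1 :=
    (intervalIntegrable_iff_integrableOn_Ioo_of_le zero_le_one).2 hi
  have hi2 : IntervalIntegrable g volume (-1) 0 := by
    rw [IntervalIntegrable.iff_comp_neg]
    simp only [hneg, neg_neg, neg_zero]
    exact (hi1.const_mul _).symm
  refine ⟨(intervalIntegrable_iff_integrableOn_Ioo_of_le (by norm_num)).1 (hi2.trans hi1), ?_⟩
  have e0 : ∫ t in (-1 : ℝ)..0, g t = (-1) ^ n * ∫ t in (0 : ℝ)..1, g t := by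
    have := intervalIntegral.integral_comp_neg (a := 0) (b := 1) g
    rw [neg_zero] at this
    rw [← this]
    simp only [hneg]
    rw [intervalIntegral.integral_const_mul]
  have hv' : ∫ t in (0 : ℝ)..1, g t =
      Real.Gamma ((n + 1) / 2) * Real.Gamma q / Real.Gamma ((n + 1) / 2 + q) / 2 := by
    rw [intervalIntegral.integral_of_le zero_le_one, integral_Ioc_eq_integral_Ioo, hv]
  rw [← integral_Ioc_eq_integral_Ioo, ← intervalIntegral.integral_of_le (by norm_num),
    ← intervalIntegral.integral_add_adjacent_intervals hi2 hi1, e0, hv']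
  ring

lemma hasSum_even {f g : ℕ → ℝ} {x : ℝ} (h : HasSum f x) (hodd : ∀ n, Odd n → f n = 0)
    (hg : ∀ j, g j = f (2 * j)) : HasSum g x := by
  rw [funext hg]
  refine (Function.Injective.hasSum_iff (g := fun j : ℕ => 2 * j)
    (fun a b hab => by simpa using hab) fun n hn => ?_).2 h
  refine hodd n (Nat.not_even_iff_odd.1 fun he => hn ?_)
  obtain ⟨j, rfl⟩ := he
  exact ⟨j, by ring⟩

lemma two_mul_div_one_add_sq_mem {r : ℝ} (hr : r ∈ Ioo (0 : ℝ) 1) :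
    2 * r / (1 + r ^ 2) ∈ Ioo (0 : ℝ) 1 := by
  have := hr.1
  have := hr.2
  refine ⟨by positivity, ?_⟩
  rw [div_lt_one (by positivity)]
  nlinarith

lemma rpow_neg_factor {a r t : ℝ} (hr : r ∈ Ioo (0 : ℝ) 1) (ht : |t| ≤ 1) :
    (1 - 2 * t * r + r ^ 2) ^ (-a) =
      (1 + r ^ 2) ^ (-a) * (1 - 2 * r / (1 + r ^ 2) * t) ^ (-a) := by
  have hz := two_mul_div_one_add_sq_mem hr
  have h1 : 2 * r / (1 + r ^ 2) * t < 1 := by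
    have := le_abs_self t
    nlinarith [hz.1, hz.2]
  rw [← Real.mul_rpow (by positivity) (by linarith)]
  congr 1
  field_simp
  ring

/-- Expansion of the angular integral in powers of `2 r / (1 + r ^ 2)`. -/
lemma integral_angularIntegrand {d : ℕ} {s r : ℝ} (hd : 2 ≤ d) (hs : 0 < s)
    (hr : r ∈ Ioo (0 : ℝ) 1) :
    IntegrableOn (fun t : ℝ => angularIntegrand d s 2 r t) (Ioo (-1) 1) ∧
    HasSum (fun j : ℕ => (1 + r ^ 2) ^ (-((d : ℝ) / 2 + s)) *
        (Real.Gamma ((d : ℝ) / 2 + s + (2 * j : ℕ)) /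
          (Real.Gamma ((d : ℝ) / 2 + s) * (2 * j).factorial) * (2 * r / (1 + r ^ 2)) ^ (2 * j)) *
        (Real.Gamma (j + 1 / 2) * Real.Gamma (((d : ℝ) - 1) / 2) / Real.Gamma ((d : ℝ) / 2 + j)))
      (∫ t in Ioo (-1 : ℝ) 1, angularIntegrand d s 2 r t) := by
  set a : ℝ := (d : ℝ) / 2 + s with ha
  set z : ℝ := 2 * r / (1 + r ^ 2) with hz
  set q : ℝ := ((d : ℝ) - 1) / 2 with hq
  have hd' : (2 : ℝ) ≤ d := by exact_mod_cast hd
  have ha0 : 0 < a := by positivity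
  have hq0 : 0 < q := by rw [hq]; linarith
  have hzm : z ∈ Ioo (0 : ℝ) 1 := two_mul_div_one_add_sq_mem hr
  have hGa := Real.Gamma_pos_of_pos ha0
  set k : ℕ → ℝ := fun n => (1 + r ^ 2) ^ (-a) *
    (Real.Gamma (a + n) / (Real.Gamma a * n.factorial) * z ^ n) with hk
  have hk0 : ∀ n, 0 ≤ k n := fun n => by
    have := Real.Gamma_pos_of_pos (show 0 < a + n by positivity)
    have := hzm.1
    positivity
  have hks : Summable k :=
    ((hasSum_one_sub_rpow_neg ha0 (by rw [abs_of_pos hzm.1]; exact hzm.2)).summable).mul_left _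
  have hm := integral_pow_mul_one_sub_sq_rpow hq0
  set w : ℝ → ℝ := fun t => (1 - t ^ 2) ^ (q - 1) with hw
  have hwi : IntegrableOn w (Ioo (-1) 1) := by simpa using (hm 0).1
  have hw0 : ∀ t ∈ Ioo (-1 : ℝ) 1, 0 ≤ w t := fun t ht =>
    Real.rpow_nonneg (by nlinarith [ht.1, ht.2]) _
  have ht1 : ∀ t ∈ Ioo (-1 : ℝ) 1, |t| < 1 := fun t ht => abs_lt.2 ht
  have hS : ∀ t ∈ Ioo (-1 : ℝ) 1,
      HasSum (fun n => k n * (t ^ n * w t)) (angularIntegrand d s 2 r t) := by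
    intro t ht
    have hb := (hasSum_one_sub_rpow_neg ha0 (x := z * t) (by
      rw [abs_mul, abs_of_pos hzm.1]
      nlinarith [ht1 t ht, abs_nonneg t, hzm.1, hzm.2])).mul_left ((1 + r ^ 2) ^ (-a) * w t)
    refine hasSum_congr hb (fun n => ?_) ?_
    · simp only [hk, mul_pow]
      ring
    · have hpos : 0 ≤ 1 - 2 * t * r + r ^ 2 := by
        nlinarith [sq_nonneg (r - t), ht.1, ht.2]
      rw [angularIntegrand, show ((d : ℝ) + s * 2) / 2 = a by rw [ha]; ring, div_eq_mul_inv,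
        ← Real.rpow_neg hpos, rpow_neg_factor hr (ht1 t ht).le, hw,
        show q - 1 = ((d : ℝ) - 3) / 2 by rw [hq]; ring]
      ring
  have hFi : ∀ n, IntegrableOn (fun t => k n * (t ^ n * w t)) (Ioo (-1) 1) := fun n =>
    (hm n).1.const_mul _
  have hsum : Summable fun n => ∫ t in Ioo (-1 : ℝ) 1, ‖k n * (t ^ n * w t)‖ := by
    refine Summable.of_nonneg_of_le (fun n => by positivity) (fun n => ?_)
      (hks.mul_right (∫ t in Ioo (-1 : ℝ) 1, w t))
    rw [← integral_const_mul]
    refine setIntegral_mono_on (hFi n).norm (hwi.const_mul _) measurableSet_Ioo fun t ht => ?_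
    rw [norm_mul (k n), norm_mul (t ^ n), Real.norm_of_nonneg (hk0 n), Real.norm_of_nonneg (hw0 t ht), norm_pow]
    have h1 : ‖t‖ ^ n ≤ 1 := pow_le_one₀ (norm_nonneg _) (ht1 t ht).le
    exact mul_le_mul_of_nonneg_left (mul_le_of_le_one_left (hw0 t ht) h1) (hk0 n)
  obtain ⟨h1, h2⟩ := integrableOn_and_hasSum_integral measurableSet_Ioo hFi hsum hS
  -- The weight `(1-t²)^(q-1)` is even, so odd moments vanish.
  refine ⟨h1, hasSum_even h2 (fun n hn => ?_) fun j => ?_⟩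
  · rw [integral_const_mul, (hm n).2, hn.neg_one_pow]
    simp
  · rw [integral_const_mul, (hm _).2, (even_two_mul j).neg_one_pow,
      show (((2 * j : ℕ) : ℝ) + 1) / 2 = j + 1 / 2 by push_cast; ring,
      show (j : ℝ) + 1 / 2 + q = (d : ℝ) / 2 + j by rw [hq]; ring]
    ring

/-- Legendre duplication. It cancels the `(2j)!` of the binomial series and the powers of 2 from
`(2r/(1+r²))^(2j)`. -/
lemma Gamma_nat_add_half_eq (j : ℕ) :
    Real.Gamma (j + 1 / 2) = (2 * j).factorial * √Real.pi / (2 ^ (2 * j) * j.factorial) := by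
  have h := Real.Gamma_mul_Gamma_add_half ((j : ℝ) + 1 / 2)
  rw [show (j : ℝ) + 1 / 2 + 1 / 2 = j + 1 by ring, Real.Gamma_nat_eq_factorial,
    show 2 * ((j : ℝ) + 1 / 2) = (2 * j : ℕ) + 1 by push_cast; ring, Real.Gamma_nat_eq_factorial,
    show (1 : ℝ) - ((2 * j : ℕ) + 1) = -((2 * j : ℕ) : ℝ) by ring, Real.rpow_neg (by norm_num),
    Real.rpow_natCast] at h
  field_simp
  field_simp at h
  linarith

/-- Expansion of `Φ` in powers of `r ^ 2 / (1 + r ^ 2) ^ 2`. -/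
lemma hasSum_Phi {d : ℕ} {s r : ℝ} (hd : 1 ≤ d) (hs : 0 < s) (hr : r ∈ Ioo (0 : ℝ) 1) :
    HasSum (fun j : ℕ => 2 * Real.pi ^ ((d : ℝ) / 2) *
        Real.Gamma ((d : ℝ) / 2 + s + (2 * j : ℕ)) /
          (Real.Gamma ((d : ℝ) / 2 + s) * (Real.Gamma ((d : ℝ) / 2 + j) * j.factorial)) *
        (r ^ (2 * j) * (1 + r ^ 2) ^ (-((d : ℝ) / 2 + s + (2 * j : ℕ)))))
      (Phi d s 2 r) := by
  have h0 := hr.1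
  have hr2 : 0 < 1 + r ^ 2 := by positivity
  have hzm := two_mul_div_one_add_sq_mem hr
  have hexp : ∀ a : ℝ, ∀ j : ℕ, (1 + r ^ 2) ^ (-(a + (2 * j : ℕ))) =
      (1 + r ^ 2) ^ (-a) / (1 + r ^ 2) ^ (2 * j) := fun a j => by
    rw [neg_add, ← sub_eq_add_neg, Real.rpow_sub hr2, Real.rpow_natCast]
  have hGa := (Real.Gamma_pos_of_pos (show 0 < (d : ℝ) / 2 + s by positivity)).ne'
  rcases hd.eq_or_lt with rfl | hd2
  · have ha0 : (0 : ℝ) < ((1 : ℕ) : ℝ) / 2 + s := by positivity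
    -- For `d = 1` the sphere is the two points `t = ±1`, where `1 - 2tr + r² = (1 - tr)²`; the same
    -- expansion is summed over them.
    have e1 : ∀ t : ℝ, |t| = 1 → (1 - t * r) ^ (-1 - s * 2) =
        (1 - 2 * t * r + r ^ 2) ^ (-(((1 : ℕ) : ℝ) / 2 + s)) := by
      intro t ht
      have ht2 : t ^ 2 = 1 := by rw [← sq_abs, ht, one_pow]
      have hp : 0 ≤ 1 - t * r := by nlinarith [le_abs_self t, hr.2]
      rw [show 1 - 2 * t * r + r ^ 2 = (1 - t * r) ^ 2 by linear_combination (-r ^ 2) * ht2,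
        ← Real.rpow_natCast (1 - t * r) 2, ← Real.rpow_mul hp]
      congr 1
      push_cast
      ring
    have hb := fun (t : ℝ) (ht : |t| = 1) => (hasSum_one_sub_rpow_neg ha0
      (x := 2 * r / (1 + r ^ 2) * t) (by
        rw [abs_mul, ht, mul_one, abs_of_pos hzm.1]; exact hzm.2)).mul_left
          ((1 + r ^ 2) ^ (-(((1 : ℕ) : ℝ) / 2 + s)))
    have hb1 := (hb 1 (by simp)).add (hb (-1) (by simp))
    rw [← rpow_neg_factor hr (by simp), ← rpow_neg_factor hr (by simp), ← e1 1 (by simp),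
      ← e1 (-1) (by simp)] at hb1
    have hP : Phi 1 s 2 r = (1 - 1 * r) ^ (-1 - s * 2) + (1 - -1 * r) ^ (-1 - s * 2) := by
      simp [Phi]
    rw [hP]
    refine hasSum_even hb1 (fun n hn => ?_) fun j => ?_
    · simp only [mul_pow, hn.neg_one_pow]
      ring
    · have hpi : Real.pi ^ (((1 : ℕ) : ℝ) / 2) = √Real.pi := by
        rw [Real.sqrt_eq_rpow]; norm_num
      have hpi0 : √Real.pi ≠ 0 := by positivity
      rw [hexp, hpi, show ((1 : ℕ) : ℝ) / 2 + j = j + 1 / 2 by push_cast; ring,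
        Gamma_nat_add_half_eq]
      simp only [mul_pow, div_pow, (even_two_mul j).neg_one_pow]
      field_simp
      ring
  · have hPhi : Phi d s 2 r = sphereArea (d - 1) *
        ∫ t in Ioo (-1 : ℝ) 1, angularIntegrand d s 2 r t := by
      rw [Phi, if_neg (by omega)]
    have hdr : (1 : ℝ) < d := by exact_mod_cast hd2
    have hq0 : 0 < ((d : ℝ) - 1) / 2 := by linarith
    have hGq := (Real.Gamma_pos_of_pos hq0).ne'
    rw [hPhi, sphereArea_eq (by omega), Nat.cast_sub hd, Nat.cast_one]
    refine hasSum_congr ((integral_angularIntegrand hd2 hs hr).2.mul_left _) (fun j => ?_) rfl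
    have hGd := (Real.Gamma_pos_of_pos (show 0 < (d : ℝ) / 2 + j by positivity)).ne'
    have hpi : Real.pi ^ ((d : ℝ) / 2) = Real.pi ^ (((d : ℝ) - 1) / 2) * √Real.pi := by
      rw [Real.sqrt_eq_rpow, ← Real.rpow_add Real.pi_pos]
      congr 1
      ring
    rw [hexp, hpi, Gamma_nat_add_half_eq]
    simp only [mul_pow, div_pow]
    field_simp

/-! ### Radial integrals -/

/-- The substitution `x = r²/(1+r²)` maps `(0,1)` onto `(0,1/2)`, half of the beta integral. -/
lemma integral_rpow_mul_one_add_sq_rpow {p q : ℝ} (hp : 0 < p) (hq : 0 < q) :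
    IntegrableOn (fun r : ℝ => r ^ (2 * p - 1) * (1 + r ^ 2) ^ (-(p + q))) (Ioo 0 1) ∧
    ∫ r in Ioo (0 : ℝ) 1, r ^ (2 * p - 1) * (1 + r ^ 2) ^ (-(p + q)) =
      (∫ x in Ioo (0 : ℝ) (1 / 2), x ^ (p - 1) * (1 - x) ^ (q - 1)) / 2 := by
  set f : ℝ → ℝ := fun r => r ^ 2 / (1 + r ^ 2) with hf
  have hpos : ∀ r : ℝ, 0 < 1 + r ^ 2 := fun r => by positivity
  have himg : f '' Ioo 0 1 = Ioo 0 (1 / 2) := by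
    ext y
    constructor
    · rintro ⟨r, hr, rfl⟩
      have := hr.1
      refine ⟨by simp only [hf]; positivity, ?_⟩
      simp only [hf]
      rw [div_lt_div_iff₀ (hpos r) two_pos]
      nlinarith [hr.1, hr.2]
    · intro hy
      have h1 : 0 < 1 - y := by linarith [hy.2]
      have h2 : 0 < y / (1 - y) := div_pos hy.1 h1
      refine ⟨√(y / (1 - y)), ⟨Real.sqrt_pos.2 h2, ?_⟩, ?_⟩
      · rw [Real.sqrt_lt' one_pos, div_lt_iff₀ h1]
        linarith [hy.2]
      · simp only [hf]
        rw [Real.sq_sqrt h2.le]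
        field_simp
        ring
  have hinj : InjOn f (Ioo 0 1) := fun x hx y hy h => by
    simp only [hf] at h
    rw [div_eq_div_iff (hpos x).ne' (hpos y).ne'] at h
    exact (pow_left_inj₀ hx.1.le hy.1.le two_ne_zero).1 (by linarith)
  have hder : ∀ x ∈ Ioo (0 : ℝ) 1,
      HasDerivWithinAt f (2 * x / (1 + x ^ 2) ^ 2) (Ioo 0 1) x := fun x _ => by
    have h := ((hasDerivAt_pow 2 x).div ((hasDerivAt_pow 2 x).const_add 1)
      (hpos x).ne').hasDerivWithinAt (s := Ioo 0 1)
    convert! h using 1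
    push_cast
    ring
  have he : ∀ r ∈ Ioo (0 : ℝ) 1,
      |2 * r / (1 + r ^ 2) ^ 2| • (f r ^ (p - 1) * (1 - f r) ^ (q - 1)) =
        2 * (r ^ (2 * p - 1) * (1 + r ^ 2) ^ (-(p + q))) := by
    intro r hr
    have h0 := hr.1
    have h1 := hpos r
    have e1 : 1 - f r = (1 + r ^ 2)⁻¹ := by simp only [hf]; field_simp; ring
    rw [abs_of_pos (by positivity), smul_eq_mul, e1, hf, Real.div_rpow (by positivity) h1.le,
      Real.inv_rpow h1.le, ← Real.rpow_neg h1.le, ← Real.rpow_natCast r 2,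
      ← Real.rpow_mul h0.le]
    rw [Real.rpow_natCast r 2, show -(p + q) = -(q - 1) + -(p - 1) - (2 : ℕ) by push_cast; ring,
      Real.rpow_sub h1 (-(q - 1) + -(p - 1)), Real.rpow_add h1 (-(q - 1)), Real.rpow_natCast, Real.rpow_neg h1.le (p - 1),
      show 2 * p - 1 = (2 : ℕ) * (p - 1) + 1 by push_cast; ring, Real.rpow_add_one h0.ne']
    field_simp
  have hi := (beta_integral hp hq).1.mono_set (Ioo_subset_Ioo_right (by norm_num : (1 / 2 : ℝ) ≤ 1))
  rw [← himg, integrableOn_image_iff_integrableOn_abs_deriv_smul measurableSet_Ioo hder hinj,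
    integrableOn_congr_fun he measurableSet_Ioo] at hi
  refine ⟨?_, ?_⟩
  · have := hi.const_mul (1 / 2)
    simpa using! this
  · rw [← himg, integral_image_eq_integral_abs_deriv_smul measurableSet_Ioo hder hinj,
      setIntegral_congr_fun measurableSet_Ioo he, integral_const_mul]
    ring

/-- The beta integral folded to `(0, 1)` along the inversion `r ↦ 1 / r`. -/
lemma folded_beta_integral {p q σ : ℝ} (hp : 0 < p) (hq : 0 < q) (hσ : p + q = σ) :
    IntegrableOn (fun r : ℝ => (r ^ (2 * p - 1) + r ^ (2 * q - 1)) * (1 + r ^ 2) ^ (-σ))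
      (Ioo 0 1) ∧
    ∫ r in Ioo (0 : ℝ) 1, (r ^ (2 * p - 1) + r ^ (2 * q - 1)) * (1 + r ^ 2) ^ (-σ) =
      Real.Gamma p * Real.Gamma q / Real.Gamma σ / 2 := by
  subst hσ
  obtain ⟨i1, v1⟩ := integral_rpow_mul_one_add_sq_rpow hp hq
  obtain ⟨i2, v2⟩ := integral_rpow_mul_one_add_sq_rpow hq hp
  rw [add_comm q p] at i2 v2
  simp only [add_mul]
  refine ⟨i1.add i2, ?_⟩
  rw [integral_add i1 i2, v1, v2]
  obtain ⟨hi, hv⟩ := beta_integral hp hq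
  rw [← hv]
  set g : ℝ → ℝ := fun x => x ^ (p - 1) * (1 - x) ^ (q - 1) with hg
  have hi' : IntervalIntegrable g volume 0 1 :=
    (intervalIntegrable_iff_integrableOn_Ioo_of_le zero_le_one).2 hi
  have hl : IntervalIntegrable g volume 0 (1 / 2) := hi'.mono_set (by
    rw [uIcc_of_le (by norm_num), uIcc_of_le (by norm_num)]
    exact Icc_subset_Icc_right (by norm_num))
  have hr : IntervalIntegrable g volume (1 / 2) 1 := hi'.mono_set (by
    rw [uIcc_of_le (by norm_num), uIcc_of_le (by norm_num)]
    exact Icc_subset_Icc_left (by norm_num))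
  -- In the variable `x` the inversion is `x ↦ 1 - x`; it carries the second power to the missing
  -- half.
  have e : ∫ x in (0 : ℝ)..(1 / 2), x ^ (q - 1) * (1 - x) ^ (p - 1) =
      ∫ x in (1 / 2 : ℝ)..1, g x := by
    have := intervalIntegral.integral_comp_sub_left (a := 0) (b := 1 / 2) g 1
    rw [sub_zero, show (1 : ℝ) - 1 / 2 = 1 / 2 by norm_num] at this
    rw [← this]
    refine intervalIntegral.integral_congr fun x _ => ?_
    simp only [hg, sub_sub_cancel]
    ring
  have h2 := intervalIntegral.integral_add_adjacent_intervals hl hr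
  rw [← e] at h2
  simp only [intervalIntegral.integral_of_le (show (0 : ℝ) ≤ 1 / 2 by norm_num),
    intervalIntegral.integral_of_le zero_le_one, integral_Ioc_eq_integral_Ioo] at h2
  rw [← h2]
  ring

/-! ### Evaluation of the Hardy constant -/

/-- The radial weight of the Hardy constant, multiplied out into six powers of `r`. -/
lemma hardy_weight_eq {D s α β r : ℝ} (hr : 0 < r) :
    r ^ (s * 2 - 1) * (r ^ α + r ^ β) * |1 - r ^ ((D - α - β - s * 2) / 2)| ^ (2 : ℝ) =
      (r ^ (2 * (s + α / 2) - 1) + r ^ (2 * ((D - α) / 2) - 1)) +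
      (r ^ (2 * (s + β / 2) - 1) + r ^ (2 * ((D - β) / 2) - 1)) -
      2 * (r ^ (2 * ((D + α - β + 2 * s) / 4) - 1) +
        r ^ (2 * ((D - α + β + 2 * s) / 4) - 1)) := by
  set x := r ^ ((D - α - β - s * 2) / 2) with hx
  have e0 : |1 - x| ^ (2 : ℝ) = (1 - x) ^ 2 := by
    rw [show (2 : ℝ) = (2 : ℕ) by norm_num, Real.rpow_natCast, sq_abs]
  have e1 : ∀ γ, r ^ (2 * (s + γ / 2) - 1) = r ^ (s * 2 - 1) * r ^ γ := fun γ => by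
    rw [← Real.rpow_add hr]; ring_nf
  have e2 : r ^ (2 * ((D - α) / 2) - 1) = r ^ (s * 2 - 1) * r ^ β * x * x := by
    rw [hx, ← Real.rpow_add hr, ← Real.rpow_add hr, ← Real.rpow_add hr]; ring_nf
  have e3 : r ^ (2 * ((D - β) / 2) - 1) = r ^ (s * 2 - 1) * r ^ α * x * x := by
    rw [hx, ← Real.rpow_add hr, ← Real.rpow_add hr, ← Real.rpow_add hr]; ring_nf
  have e4 : r ^ (2 * ((D + α - β + 2 * s) / 4) - 1) = r ^ (s * 2 - 1) * r ^ α * x := by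
    rw [hx, ← Real.rpow_add hr, ← Real.rpow_add hr]; ring_nf
  have e5 : r ^ (2 * ((D - α + β + 2 * s) / 4) - 1) = r ^ (s * 2 - 1) * r ^ β * x := by
    rw [hx, ← Real.rpow_add hr, ← Real.rpow_add hr]; ring_nf
  rw [e0, e1, e1, e2, e3, e4, e5]
  ring

/-- Evaluation of the Hardy constant as `|Γ(-s)|` times a combination of Gamma quotients. -/
lemma hardyConst_eq {d : ℕ} (hd : 1 ≤ d) {s α β : ℝ} (hs0 : 0 < s) (hs1 : s < 1)
    (hα : α ∈ Ioo (-2 * s) (d : ℝ)) (hβ : β ∈ Ioo (-2 * s) (d : ℝ)) :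
    IntegrableOn (fun r : ℝ => hardyIntegrand d s 2 α β r) (Ioo 0 1) ∧
    hardyConst d s 2 α β =
      Real.pi ^ ((d : ℝ) / 2) * |Real.Gamma (-s)| / Real.Gamma (((d : ℝ) + 2 * s) / 2) *
        (2 * Real.Gamma (((d : ℝ) - α + β + 2 * s) / 4) *
            Real.Gamma (((d : ℝ) + α - β + 2 * s) / 4) /
            (Real.Gamma (((d : ℝ) + α - β - 2 * s) / 4) *
              Real.Gamma (((d : ℝ) - α + β - 2 * s) / 4))
          - Real.Gamma ((α + 2 * s) / 2) * Real.Gamma (((d : ℝ) - α) / 2) /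
            (Real.Gamma (((d : ℝ) - α - 2 * s) / 2) * Real.Gamma (α / 2))
          - Real.Gamma ((β + 2 * s) / 2) * Real.Gamma (((d : ℝ) - β) / 2) /
            (Real.Gamma (((d : ℝ) - β - 2 * s) / 2) * Real.Gamma (β / 2))) := by
  obtain ⟨hα1, hα2⟩ := hα
  obtain ⟨hβ1, hβ2⟩ := hβ
  have hd0 : (0 : ℝ) < d := by exact_mod_cast hd
  set c : ℝ := (d : ℝ) / 2 with hc
  have hc0 : 0 < c := by positivity
  set u : ℝ := s + α / 2 with hu
  set v : ℝ := ((d : ℝ) - α) / 2 with hv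
  set u' : ℝ := s + β / 2 with hu'
  set v' : ℝ := ((d : ℝ) - β) / 2 with hv'
  set w : ℝ := ((d : ℝ) + α - β + 2 * s) / 4 with hw
  set w' : ℝ := ((d : ℝ) - α + β + 2 * s) / 4 with hw'
  have hu0 : 0 < u := by linarith
  have hv0 : 0 < v := by linarith
  have hu0' : 0 < u' := by linarith
  have hv0' : 0 < v' := by linarith
  have hw0 : 0 < w := by linarith
  have hw0' : 0 < w' := by linarith
  -- The common sum `c + s` makes each pair foldable and gives all three Gauss series the same
  -- growth.
  have huv : u + v = c + s := by rw [hu, hv, hc]; ring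
  have huv' : u' + v' = c + s := by rw [hu', hv', hc]; ring
  have hww' : w + w' = c + s := by rw [hw, hw', hc]; ring
  have hGa := Real.Gamma_pos_of_pos (show 0 < c + s by positivity)
  have hG : ∀ {x : ℝ}, 0 < x → ∀ n : ℕ, 0 < Real.Gamma (x + n) := fun hx n =>
    Real.Gamma_pos_of_pos (by positivity)
  set K : ℕ → ℝ := fun j => 2 * Real.pi ^ c * Real.Gamma (c + s + (2 * j : ℕ)) /
    (Real.Gamma (c + s) * (Real.Gamma (c + j) * j.factorial)) with hK
  have hK0 : ∀ j, 0 ≤ K j := fun j => by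
    have := hG (show 0 < c + s by positivity) (2 * j)
    have := hG hc0 j
    positivity
  set W : ℝ → ℝ := fun r => r ^ (s * 2 - 1) * (r ^ α + r ^ β) *
    |1 - r ^ (((d : ℝ) - α - β - s * 2) / 2)| ^ (2 : ℝ) with hW
  have hW0 : ∀ r ∈ Ioo (0 : ℝ) 1, 0 ≤ W r := fun r hr => by
    have := hr.1
    positivity
  set F : ℕ → ℝ → ℝ := fun j r =>
    K j * (W r * (r ^ (2 * j) * (1 + r ^ 2) ^ (-(c + s + (2 * j : ℕ))))) with hF
  have hF0 : ∀ j, ∀ r ∈ Ioo (0 : ℝ) 1, 0 ≤ F j r := fun j r hr => by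
    have := hr.1
    have := hW0 r hr
    have := hK0 j
    positivity
  have hFS : ∀ r ∈ Ioo (0 : ℝ) 1, HasSum (fun j => F j r) (hardyIntegrand d s 2 α β r) := by
    intro r hr
    refine hasSum_congr ((hasSum_Phi hd hs0 hr).mul_left (W r)) (fun j => ?_) rfl
    simp only [hF, hK]
    ring
  -- The factor `Γ(c+s+2j)` in `K j` cancels the denominator of the beta integrals. The cross term,
  -- with coefficient -2, supplies one subtraction for each of the two squares.
  have hFI : ∀ j, IntegrableOn (F j) (Ioo 0 1) ∧ ∫ r in Ioo (0 : ℝ) 1, F j r =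
      Real.pi ^ c / Real.Gamma (c + s) *
        ((gaussTerm u v c j - gaussTerm w w' c j) +
          (gaussTerm u' v' c j - gaussTerm w w' c j)) := by
    intro j
    have hfb := fun {x y : ℝ} (hx : 0 < x) (hy : 0 < y) (h : x + y = c + s) =>
      folded_beta_integral (p := x + j) (q := y + j) (σ := c + s + (2 * j : ℕ))
        (by positivity) (by positivity) (by push_cast; linarith)
    obtain ⟨i1, v1⟩ := hfb hu0 hv0 huv
    obtain ⟨i2, v2⟩ := hfb hu0' hv0' huv'
    obtain ⟨i3, v3⟩ := hfb hw0 hw0' hww'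
    have e : ∀ r ∈ Ioo (0 : ℝ) 1, K j *
        ((r ^ (2 * (u + j) - 1) + r ^ (2 * (v + j) - 1)) *
            (1 + r ^ 2) ^ (-(c + s + (2 * j : ℕ))) +
          (r ^ (2 * (u' + j) - 1) + r ^ (2 * (v' + j) - 1)) *
            (1 + r ^ 2) ^ (-(c + s + (2 * j : ℕ))) -
          2 * ((r ^ (2 * (w + j) - 1) + r ^ (2 * (w' + j) - 1)) *
            (1 + r ^ 2) ^ (-(c + s + (2 * j : ℕ))))) = F j r := by
      intro r hr
      have e1 : ∀ x : ℝ, r ^ (2 * (x + j) - 1) = r ^ (2 * x - 1) * r ^ (2 * j) := fun x => by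
        rw [← Real.rpow_natCast r (2 * j), ← Real.rpow_add hr.1]
        push_cast
        ring_nf
      simp only [hF, hW, e1, hardy_weight_eq hr.1]
      ring
    have i12 : IntegrableOn (fun r : ℝ =>
        (r ^ (2 * (u + j) - 1) + r ^ (2 * (v + j) - 1)) *
            (1 + r ^ 2) ^ (-(c + s + (2 * j : ℕ))) +
          (r ^ (2 * (u' + j) - 1) + r ^ (2 * (v' + j) - 1)) *
            (1 + r ^ 2) ^ (-(c + s + (2 * j : ℕ)))) (Ioo 0 1) := i1.add i2
    refine ⟨(integrableOn_congr_fun e measurableSet_Ioo).1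
      ((i12.sub (i3.const_mul 2)).const_mul (K j)), ?_⟩
    rw [← setIntegral_congr_fun measurableSet_Ioo e, integral_const_mul,
      integral_sub i12 (i3.const_mul 2), integral_add i1 i2, integral_const_mul,
      v1, v2, v3]
    have h1 := (hG (show 0 < c + s by positivity) (2 * j)).ne'
    have h2 := (hG hc0 j).ne'
    simp only [hK, gaussTerm]
    field_simp
    ring
  have hlim := ((tendsto_sum_gaussTerm_sub hu0 hv0 hw0 hw0' hc0 hs0 hs1 huv hww').add
    (tendsto_sum_gaussTerm_sub hu0' hv0' hw0 hw0' hc0 hs0 hs1 huv' hww')).const_mul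
      (Real.pi ^ c / Real.Gamma (c + s))
  simp only [← Finset.sum_add_distrib, Finset.mul_sum, ← (hFI _).2] at hlim
  have hFn : ∀ j, 0 ≤ ∫ r in Ioo (0 : ℝ) 1, F j r := fun j =>
    setIntegral_nonneg measurableSet_Ioo (hF0 j)
  -- Nonnegativity upgrades the limit of partial sums to summability of the `L¹` norms, hence
  -- integrability.
  have hsum := (hasSum_iff_tendsto_nat_of_nonneg hFn _).2 hlim
  have hnorm : Summable fun j => ∫ r in Ioo (0 : ℝ) 1, ‖F j r‖ := by
    refine hsum.summable.congr fun j => ?_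
    exact setIntegral_congr_fun measurableSet_Ioo fun r hr =>
      (Real.norm_of_nonneg (hF0 j r hr)).symm
  obtain ⟨h1, h2⟩ := integrableOn_and_hasSum_integral measurableSet_Ioo (fun j => (hFI j).1)
    hnorm hFS
  refine ⟨h1, ?_⟩
  -- `Γ(1-s) = -s Γ(-s)` is positive, so `Γ(-s) < 0`; this reverses the signs of the differences.
  have hneg : |Real.Gamma (-s)| = -Real.Gamma (-s) := by
    refine abs_of_neg ?_
    have h3 := Real.Gamma_add_one (s := -s) (by linarith)
    have h4 := Real.Gamma_pos_of_pos (show 0 < -s + 1 by linarith)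
    by_contra! h5
    nlinarith
  rw [hardyConst, h2.unique hsum, hneg]
  rw [show ((d : ℝ) + 2 * s) / 2 = c + s by rw [hc]; ring,
    show ((d : ℝ) + α - β - 2 * s) / 4 = c - w' by rw [hc, hw']; ring,
    show ((d : ℝ) - α + β - 2 * s) / 4 = c - w by rw [hc, hw]; ring,
    show (α + 2 * s) / 2 = u by rw [hu]; ring,
    show ((d : ℝ) - α - 2 * s) / 2 = c - u by rw [hc, hu]; ring,
    show α / 2 = c - v by rw [hc, hv]; ring,
    show (β + 2 * s) / 2 = u' by rw [hu']; ring,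
    show ((d : ℝ) - β - 2 * s) / 2 = c - u' by rw [hc, hu']; ring,
    show β / 2 = c - v' by rw [hc, hv']; ring]
  ring

end WeightedHardy

end

/-- The function `1/Γ` is understood to vanish at the poles `0, -1, -2, …` of `Γ`; this is what
division by `Real.Gamma` gives, and no factor `Γ` in a numerator below is taken at a pole. -/
theorem proposition3p2 (d : ℕ) (hd : 1 ≤ d) (s : ℝ) (hs0 : 0 < s) (hs1 : s < 1) :
    (∀ α β : ℝ, α ∈ Set.Ioo (-2 * s) (d : ℝ) → β ∈ Set.Ioo (-2 * s) (d : ℝ) →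
      α + β ∈ Set.Ioo (-2 * s) (d : ℝ) →
        (2 ≤ d → ∀ r ∈ Set.Ioo (0 : ℝ) 1,
          IntegrableOn (fun t : ℝ => WeightedHardy.angularIntegrand d s 2 r t)
            (Set.Ioo (-1 : ℝ) 1) volume) ∧
        IntegrableOn (fun r : ℝ => WeightedHardy.hardyIntegrand d s 2 α β r)
          (Set.Ioo (0 : ℝ) 1) volume ∧
        WeightedHardy.hardyConst d s 2 α β =
          Real.pi ^ ((d : ℝ) / 2) * |Real.Gamma (-s)| / Real.Gamma (((d : ℝ) + 2 * s) / 2) *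
            (2 * Real.Gamma (((d : ℝ) - α + β + 2 * s) / 4) *
                Real.Gamma (((d : ℝ) + α - β + 2 * s) / 4) /
                (Real.Gamma (((d : ℝ) + α - β - 2 * s) / 4) *
                  Real.Gamma (((d : ℝ) - α + β - 2 * s) / 4))
              - Real.Gamma ((α + 2 * s) / 2) * Real.Gamma (((d : ℝ) - α) / 2) /
                (Real.Gamma (((d : ℝ) - α - 2 * s) / 2) * Real.Gamma (α / 2))
              - Real.Gamma ((β + 2 * s) / 2) * Real.Gamma (((d : ℝ) - β) / 2) /
                (Real.Gamma (((d : ℝ) - β - 2 * s) / 2) * Real.Gamma (β / 2)))) ∧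
    (∀ α : ℝ, α ∈ Set.Ioo (-2 * s) (d : ℝ) → α + α ∈ Set.Ioo (-2 * s) (d : ℝ) →
        WeightedHardy.hardyConst d s 2 α α =
          2 * Real.pi ^ ((d : ℝ) / 2) * |Real.Gamma (-s)| / Real.Gamma (((d : ℝ) + 2 * s) / 2) *
            (Real.Gamma (((d : ℝ) + 2 * s) / 4) ^ 2 / Real.Gamma (((d : ℝ) - 2 * s) / 4) ^ 2
              - Real.Gamma ((α + 2 * s) / 2) * Real.Gamma (((d : ℝ) - α) / 2) /
                (Real.Gamma (((d : ℝ) - α - 2 * s) / 2) * Real.Gamma (α / 2)))) ∧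
    WeightedHardy.hardyConst d s 2 0 0 =
      2 * Real.pi ^ ((d : ℝ) / 2) * |Real.Gamma (-s)| *
          Real.Gamma (((d : ℝ) + 2 * s) / 4) ^ 2 /
        (Real.Gamma (((d : ℝ) + 2 * s) / 2) * Real.Gamma (((d : ℝ) - 2 * s) / 4) ^ 2) := by
  have h2 : ∀ α : ℝ, α ∈ Set.Ioo (-2 * s) (d : ℝ) →
      WeightedHardy.hardyConst d s 2 α α =
          2 * Real.pi ^ ((d : ℝ) / 2) * |Real.Gamma (-s)| / Real.Gamma (((d : ℝ) + 2 * s) / 2) *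
            (Real.Gamma (((d : ℝ) + 2 * s) / 4) ^ 2 / Real.Gamma (((d : ℝ) - 2 * s) / 4) ^ 2
              - Real.Gamma ((α + 2 * s) / 2) * Real.Gamma (((d : ℝ) - α) / 2) /
                (Real.Gamma (((d : ℝ) - α - 2 * s) / 2) * Real.Gamma (α / 2))) := by
    intro α hα
    rw [(WeightedHardy.hardyConst_eq hd hs0 hs1 hα hα).2, sub_add_cancel, add_sub_cancel_right]
    ring
  refine ⟨fun α β hα hβ _ => ⟨fun hd2 r hr =>
    (WeightedHardy.integral_angularIntegrand hd2 hs0 hr).1,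
    WeightedHardy.hardyConst_eq hd hs0 hs1 hα hβ⟩, fun α hα _ => h2 α hα, ?_⟩
  have hd0 : (0 : ℝ) < d := by exact_mod_cast hd
  -- At `α = 0` the subtracted quotient contains `1/Γ(0)`, which is 0 by convention.
  rw [h2 0 ⟨by linarith, hd0⟩, zero_div, Real.Gamma_zero, mul_zero, div_zero, sub_zero,
    div_mul_div_comm]
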